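/- **Setting.** Let $V$ be a commutative unital quantale: a complete lattice with a commutative monoid structure $(\otimes,k)$ whose tensor preserves joins in each variable; $\hom(u,-)$ denotes the right adjoint of $u\otimes-$. Assume that $k\neq\bot$ and that $V$ is constructively completely distributive, i.e. the join map from the down-sets of $V$ to $V$ has a left adjoint. Let $\mathbb T=(T,e,m)$ be a monad on $\mathbf{Set}$ which is non-trivial (neither $TX=1$ for all $X$, nor $T\varnothing=\varnothing$ and $TX=1$ for all $X\neq\varnothing$), such that $T$ sends pullbacks to weak pullbacks and every naturality square of $m$ is a weak pullback. A relation $R\subseteq X\times Y$ with projections $q,p$ is sent to the relation $TR=\{(Tq(\mathfrak w),Tp(\mathfrak w))\mid \mathfrak w\in T(R)\}$ between $TX$ and $TY$, and $T$ is extended to maps $a:X\times Y\to V$ by $$Ta(\mathfrak x,\mathfrak y)=\bigvee\{v\in V\mid (\mathfrak x,\mathfrak y)\in T(\{(x,y)\mid a(x,y)\ge v\})\}.$$ Put $\xi:TV\to V$, $\xi(\mathfrak v)=\bigvee\{v\in V\mid \mathfrak v\in T(\uparrow v)\}$, where $\uparrow v=\{u\in V\mid v\le u\}$ and $T(\uparrow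 v)$ is identified with its image in $TV$. Assume that $\xi(T\pi_1(\mathfrak w))\otimes\xi(T\pi_2(\mathfrak w))=\xi(T(\otimes)(\mathfrak w))$ for all $\mathfrak w\in T(V\times V)$. **$(\mathbb T,V)$-categories.** A $(\mathbb T,V)$-category $(X,a)$ is a set $X$ with a map $a:TX\times X\to V$ such that $k\le a(e_X(x),x)$ and $Ta(\mathfrak X,\mathfrak x)\otimes a(\mathfrak x,x)\le a(m_X(\mathfrak X),x)$ for all $\mathfrak X\in TTX$, $\mathfrak x\in TX$, $x\in X$. A map $f:X\to Y$ is a $(\mathbb T,V)$-functor $(X,a)\to(Y,b)$ if $a(\mathfrak x,x)\le b(Tf(\mathfrak x),f(x))$ for all $\mathfrak x\in TX$, $x\in X$, and it is full and faithful if $a(\mathfrak x,x)=b(Tf(\mathfrak x),f(x))$ for all $\mathfrak x\in TX$, $x\in X$. The object $V$ carries the structure $\hom_\xi(\mathfrak v,v)=\hom(\xi(\mathfrak v),v)$. The structure of $(X,a)\otimes(Y,b)$ on $X\times Y$ is $(\mathfrak w,(x,y))\mapsto a(T\pi_X(\mathfrak w),x)\otimes b(T\pi_Y(\mathfrak w),y)$.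 Let $P=(1,p)$ with $p(e_1(\star),\star)=k$ and $p(\mathfrak t,\star)=\bot$ for $\mathfrak t\ne e_1(\star)$. **Presheaves.** Let $(X,a)$ be a $(\mathbb T,V)$-category. Let $|X|$ be the set $TX$ with structure $\mu(\mathfrak X,\mathfrak x)=k$ if $m_X(\mathfrak X)=\mathfrak x$ and $\bot$ otherwise. The dual $X^{\mathrm{op}}$ is $TX$ with structure $$a^{\mathrm{op}}(\mathfrak X,\mathfrak x)=T(c)(\mathfrak X,e_{TX}(\mathfrak x)),\qquad c(\mathfrak x,\mathfrak y)=\bigvee_{\mathfrak Y\in TTX,\ m_X(\mathfrak Y)=\mathfrak y}Ta(\mathfrak Y,\mathfrak x)\quad(\mathfrak x,\mathfrak y\in TX).$$ $V^{|X|}$ is the set of maps $h:TX\to V$ for which $(\mathfrak x,\star)\mapsto h(\mathfrak x)$ is a $(\mathbb T,V)$-functor $|X|\otimes P\to V$. For $\mathfrak p\in T(V^{|X|})$ and $h\in V^{|X|}$, its structure takes as value at $(\mathfrak p,h)$ the join of all $v\in V$ such that $$\mu(T\pi_1(\mathfrak q),\mathfrak x)\otimes v\le\hom_\xi(T\mathrm{ev}(\mathfrak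 q),h(\mathfrak x))$$ for all $\mathfrak x\in TX$ and all $\mathfrak q\in T(TX\times V^{|X|})$ with $T\pi_2(\mathfrak q)=\mathfrak p$, where $\mathrm{ev}(\mathfrak x,h)=h(\mathfrak x)$. Let $\hat X$ be the set of those $\varphi\in V^{|X|}$ that are $(\mathbb T,V)$-functors $X^{\mathrm{op}}\to V$, with the structure $\hat a$ obtained by restricting that of $V^{|X|}$ along the inclusion $\hat X\hookrightarrow V^{|X|}$. **Corollary 4.2 (Yoneda full and faithful).** Assume $T1=1$. Then, for every $(\mathbb T,V)$-category $(X,a)$, $(\hat X,\hat a)$ is a $(\mathbb T,V)$-category, $a(-,x)\in\hat X$ for each $x\in X$, and the Yoneda map $y:X\to\hat X$, $y(x)=a(-,x)$, is a full and faithful $(\mathbb T,V)$-functor $(X,a)\to(\hat X,\hat a)$. -/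

import Mathlib

open CategoryTheory

open scoped Quantale

universe u

namespace TVCat

noncomputable section

/-! ### The set monad -/

/-- The action `T f : T X → T Y` of the underlying functor of `T` on a map `f`. -/
def fmap (T : Monad (Type u)) {X Y : Type u} (f : X → Y) : T.obj X → T.obj Y :=
  fun x => T.map (TypeCat.ofHom f) x

/-- The unit `e_X : X → T X`. -/
def unit (T : Monad (Type u)) {X : Type u} : X → T.obj X :=
  fun x => T.η.app X x

/-- The multiplication `m_X : T T X → T X`. -/
def mult (T : Monad (Type u)) {X : Type u} : T.obj (T.obj X) → T.obj X :=
  fun x => T.μ.app X x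

/-- `T` is not one of the two trivial monads: the one with `T X = 1` for every set `X`, and the one
with `T ∅ = ∅` and `T X = 1` for every nonempty set `X`. -/
def Nontrivial (T : Monad (Type u)) : Prop :=
  (¬ ∀ X : Type u, Nonempty (T.obj X ≃ PUnit.{u + 1})) ∧
  (¬ (IsEmpty (T.obj PEmpty.{u + 1}) ∧
      ∀ X : Type u, Nonempty X → Nonempty (T.obj X ≃ PUnit.{u + 1})))

/-- (BC) for the functor `T`: it sends pullbacks to weak pullbacks. -/
def FunctorBC (T : Monad (Type u)) : Prop :=
  ∀ (X Y Z : Type u) (f : X → Z) (g : Y → Z) (x : T.obj X) (y : T.obj Y),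
    fmap T f x = fmap T g y →
      ∃ w : T.obj {p : X × Y // f p.1 = g p.2},
        fmap T (fun p => p.1.1) w = x ∧ fmap T (fun p => p.1.2) w = y

/-- (BC) for the multiplication: each naturality square of `m` is a weak pullback. -/
def MultBC (T : Monad (Type u)) : Prop :=
  ∀ (X Y : Type u) (f : X → Y) (x : T.obj X) (y : T.obj (T.obj Y)),
    fmap T f x = mult T y →
      ∃ w : T.obj (T.obj X), mult T w = x ∧ fmap T (fmap T f) w = y

/-! ### The quantale -/

/-- A complete lattice is constructively completely distributive if the map `⋁` from its down-sets
to itself has a left adjoint. -/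
def IsCCD (V : Type u) [CompleteLattice V] : Prop :=
  ∃ d : V → LowerSet V, GaloisConnection d (fun s : LowerSet V => sSup (s : Set V))

section

variable (T : Monad (Type u)) (V : Type u) [CompleteLattice V] [CommMonoid V]

open Classical in
/-- The `V`-matrix of a map `f`: it is `k` on the graph of `f` and `⊥` elsewhere. -/
def graph {X Y : Type u} (f : X → Y) : X → Y → V :=
  fun x y => if f x = y then 1 else ⊥

/-- The extension of `T` to `V`-matrices: `T a (x, y)` is the join of all `v` such that the pair
`(x, y)` belongs to `T a_v`, where `a_v = {(x, y) | v ≤ a x y}` and a relation `R`, with projections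
`q` and `p`, is sent to the relation `T p · (T q)°`. -/
def ext {V : Type u} [CompleteLattice V] {X Y : Type u} (a : X → Y → V) :
    T.obj X → T.obj Y → V :=
  fun x y => sSup {v : V | ∃ w : T.obj {p : X × Y // v ≤ a p.1 p.2},
    fmap T (fun p => p.1.1) w = x ∧ fmap T (fun p => p.1.2) w = y}

/-- The structure map `ξ : T V → V`, `ξ x = ⋁ {v | x ∈ T (↑ v)}`, where `T (↑ v)` is identified with
its image in `T V`. -/
def xi {V : Type u} [CompleteLattice V] : T.obj V → V :=
  fun x => sSup {v : V | ∃ w : T.obj {u : V // v ≤ u}, fmap T (fun u => u.1) w = x}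

/-- Compatibility of the tensor with `ξ`: `⊗ · ⟨ξ · T π₁, ξ · T π₂⟩ = ξ · T (⊗)`. -/
def TensorCompatible : Prop :=
  ∀ w : T.obj (V × V),
    xi T (fmap T Prod.fst w) * xi T (fmap T Prod.snd w) =
      xi T (fmap T (fun p : V × V => p.1 * p.2) w)

end

section

variable {T : Monad (Type u)} {V : Type u} [CompleteLattice V] [CommMonoid V]

/-! ### `(T, V)`-categories and `(T, V)`-functors -/

variable (T) in
/-- `a` is a `(T, V)`-category structure on `X`. -/
structure IsCat {X : Type u} (a : T.obj X → X → V) : Prop where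
  refl : ∀ x : X, 1 ≤ a (unit T x) x
  trans : ∀ (x'' : T.obj (T.obj X)) (x' : T.obj X) (x : X),
    ext T a x'' x' * a x' x ≤ a (mult T x'') x

variable (T) in
/-- `f : (X, a) → (Y, b)` is a `(T, V)`-functor. -/
def IsFunctor {X Y : Type u} (a : T.obj X → X → V) (b : T.obj Y → Y → V) (f : X → Y) : Prop :=
  ∀ (x' : T.obj X) (x : X), a x' x ≤ b (fmap T f x') (f x)

variable (T) in
/-- `f : (X, a) → (Y, b)` is full and faithful. -/
def IsFullyFaithful {X Y : Type u} (a : T.obj X → X → V) (b : T.obj Y → Y → V)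
    (f : X → Y) : Prop :=
  ∀ (x' : T.obj X) (x : X), a x' x = b (fmap T f x') (f x)

/-! ### The objects built from a `(T, V)`-category -/

/-- The structure of the tensor product `(X, a) ⊗ (Y, b)` on `X × Y`. -/
def tensorStr {X Y : Type u} (a : T.obj X → X → V) (b : T.obj Y → Y → V) :
    T.obj (X × Y) → X × Y → V :=
  fun w p => a (fmap T Prod.fst w) p.1 * b (fmap T Prod.snd w) p.2

variable (T V) in
/-- The structure `p = e₁°` of the `(T, V)`-category `P = (1, p)`. -/
def pointStr : T.obj PUnit.{u + 1} → PUnit.{u + 1} → V :=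
  fun t s => graph V (unit T) s t

variable (T V) in
/-- The structure of `|X| = (T X, m_X)`: the `V`-matrix of the map `m_X`. -/
def freeStr (X : Type u) : T.obj (T.obj X) → T.obj X → V :=
  graph V (mult T)

variable (T V) in
/-- The canonical structure `hom_ξ = hom · ξ` on `V`. -/
def homXi : T.obj V → V → V :=
  fun x v => xi T x ⇨ᵣ v

/-- The `V`-category structure `T a · m_X°` on `T X`, that of `M° (X, a)`. -/
def mStr {X : Type u} (a : T.obj X → X → V) : T.obj X → T.obj X → V :=
  fun y x => ⨆ (z : T.obj (T.obj X)) (_ : mult T z = y), ext T a z x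

/-- The `(T, V)`-category structure `e_Z° · T c` on `Z`, that of `E° (Z, c)`, for a `V`-category
`(Z, c)`. -/
def eStr {Z : Type u} (c : Z → Z → V) : T.obj Z → Z → V :=
  fun z' z => ext T c z' (unit T z)

/-- The structure on `T X` of the dual `X^op = E° (M° (X)^op)`. -/
def opStr {X : Type u} (a : T.obj X → X → V) : T.obj (T.obj X) → T.obj X → V :=
  eStr (fun x y => mStr a y x)

/-- The underlying set of the function space `(Y, b) ^ (X, a)`: the maps `h` that are
`(T, V)`-functors `(X, a) ⊗ (1, p) → (Y, b)`, with `X × 1` identified with `X`. -/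
def FunSpace {X Y : Type u} (a : T.obj X → X → V) (b : T.obj Y → Y → V) : Type u :=
  {h : X → Y // IsFunctor T (tensorStr a (pointStr T V)) b (fun p => h p.1)}

/-- The structure of the function space `(Y, b) ^ (X, a)`. -/
def funStr {X Y : Type u} (a : T.obj X → X → V) (b : T.obj Y → Y → V) :
    T.obj (FunSpace a b) → FunSpace a b → V :=
  fun r h => sSup {v : V | ∀ (q : T.obj (X × FunSpace a b)) (x : X),
    fmap T Prod.snd q = r →
      a (fmap T Prod.fst q) x * v ≤
        b (fmap T (fun s : X × FunSpace a b => s.2.1 s.1) q) (h.1 x)}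

/-- The underlying set of `V ^ |X|`. -/
abbrev Presheaf (T : Monad (Type u)) (V : Type u) [CompleteLattice V] [CommMonoid V]
    (X : Type u) : Type u :=
  FunSpace (freeStr T V X) (homXi T V)

/-- The underlying set of `X̂`: those `φ` in `V ^ |X|` that are `(T, V)`-functors `X^op → V`. -/
def Hat {X : Type u} (a : T.obj X → X → V) : Type u :=
  {φ : Presheaf T V X // IsFunctor T (opStr a) (homXi T V) φ.1}

/-- The structure of `X̂` as a subcategory of `V ^ |X|`: the restriction along the inclusion. -/
def hatStr {X : Type u} (a : T.obj X → X → V) : T.obj (Hat a) → Hat a → V :=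
  fun r φ => funStr (freeStr T V X) (homXi T V) (fmap T (fun ψ : Hat a => ψ.1) r) φ.1

end

end

end TVCat

namespace TVCat

noncomputable section

/-! ### Monad laws, and consequences of $T1=1$ and of non-triviality -/

section SetMonad

variable {T : Monad (Type u)} {X Y Z : Type u}

/-! Since $T1=1$, the structure of $P$ is constantly $k$, and $\mu$ is the graph of $m$. Hence $v$
lies below the structure of $V^{|X|}$ at $(\mathfrak p,h)$ iff $v\otimes\xi(T\mathrm{ev}(\mathfrak
q))\le h(m(T\pi_1\mathfrak q))$ for every $\mathfrak q$ over $\mathfrak p$ (`le_funStr_iff`).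

Yoneda: if $\mathfrak q$ lies over $Ty(\mathfrak x)$, (BC) lifts it along $y$, so that $\mathrm{ev}$
becomes $a$. Then $\xi(T\mathrm{ev}(\mathfrak q))\le Ta(T\pi_1\mathfrak q,\mathfrak x)$ by
`xi_fmap_le_ext`, and transitivity of $a$ gives one inequality. The other comes from the single test
$\mathfrak q=T\langle e,y\rangle(\mathfrak x)$, by reflexivity of $a$ and $m\cdot Te=1$.

Transitivity of $V^{|X|}$, inherited by $\hat X$, rests on `mul_xi_fmap_le` and `xi_mult_le`. -/

lemma fmap_comp (f : X → Y) (g : Y → Z) (x : T.obj X) :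
    fmap T g (fmap T f x) = fmap T (fun a => g (f a)) x := by
  have h := T.map_comp (TypeCat.ofHom f) (TypeCat.ofHom g)
  exact (congrArg (fun k => k x) h).symm

lemma fmap_id (x : T.obj X) : fmap T (fun a => a) x = x :=
  congrArg (fun k => k x) (T.map_id X)

lemma fmap_unit (f : X → Y) (x : X) : fmap T f (unit T x) = unit T (f x) :=
  (congrArg (fun k => k x) (T.η.naturality (TypeCat.ofHom f))).symm

lemma fmap_mult (f : X → Y) (x : T.obj (T.obj X)) :
    fmap T f (mult T x) = mult T (fmap T (fmap T f) x) :=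
  (congrArg (fun k => k x) (T.μ.naturality (TypeCat.ofHom f))).symm

lemma mult_unit (x : T.obj X) : mult T (unit T x) = x :=
  congrArg (fun k => k x) (T.left_unit X)

lemma mult_fmap_unit (x : T.obj X) : mult T (fmap T (unit T) x) = x :=
  congrArg (fun k => k x) (T.right_unit X)

lemma mult_fmap_mult (x : T.obj (T.obj (T.obj X))) :
    mult T (fmap T (mult T) x) = mult T (mult T x) :=
  congrArg (fun k => k x) (T.assoc X)

/-- A constant map factors through $1$, and $e_1(\star)$ is the only element of $T1$. -/
lemma fmap_const (hT1 : Nonempty (T.obj PUnit.{u + 1} ≃ PUnit.{u + 1})) (y : Y) (x : T.obj X) :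
    fmap T (fun _ => y) x = unit T y := by
  obtain ⟨i⟩ := hT1
  have h : fmap T (fun _ => PUnit.unit) x = unit T PUnit.unit := i.injective rfl
  have h' := congrArg (fmap T (fun _ : PUnit.{u + 1} => y)) h
  rwa [fmap_comp, fmap_unit] at h'

/-- If the unit does not separate the points of some set, then `T` is trivial. -/
lemma unit_injective (hT : Nontrivial T) : Function.Injective (unit T : X → T.obj X) := by
  classical
  intro x y hxy
  by_contra hne
  have hconst : ∀ {Z : Type u} (p q : Z), unit T p = unit T q := by
    intro Z p q
    have h := congrArg (fmap T (fun z => if z = x then p else q)) hxy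
    simpa [fmap_unit, Ne.symm hne] using h
  have hsub : ∀ {Z : Type u} (p q : T.obj Z), p = q := by
    intro Z p q
    rw [← mult_unit p, ← mult_unit q, hconst p q]
  have hequiv : ∀ {Z : Type u}, T.obj Z → Nonempty (T.obj Z ≃ PUnit.{u + 1}) := fun t =>
    ⟨⟨fun _ => PUnit.unit, fun _ => t, fun _ => hsub _ _, fun _ => rfl⟩⟩
  by_cases he : IsEmpty (T.obj PEmpty.{u + 1})
  · exact hT.2 ⟨he, fun Z ⟨z⟩ => hequiv (unit T z)⟩
  · obtain ⟨t⟩ := not_isEmpty_iff.mp he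
    exact hT.1 fun Z => hequiv (fmap T PEmpty.elim t)

end SetMonad

/-! ### Membership in the image of `T` of a subset -/

/-- `w` belongs to the image of `T {x | P x}` in `T X`. -/
def Holds (T : Monad (Type u)) {X : Type u} (P : X → Prop) (w : T.obj X) : Prop :=
  ∃ w' : T.obj {x // P x}, fmap T (fun x => x.1) w' = w

section Holds

variable {T : Monad (Type u)} {X Y : Type u}

lemma Holds.mono {P Q : X → Prop} (h : ∀ x, P x → Q x) {w : T.obj X} (hw : Holds T P w) :
    Holds T Q w := by
  obtain ⟨w', rfl⟩ := hw
  exact ⟨fmap T (fun x => ⟨x.1, h _ x.2⟩) w', fmap_comp _ _ _⟩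

lemma Holds.of_forall {P : X → Prop} (h : ∀ x, P x) (w : T.obj X) : Holds T P w :=
  ⟨fmap T (fun x => ⟨x, h x⟩) w, (fmap_comp _ _ _).trans (fmap_id w)⟩

lemma Holds.fmap {P : Y → Prop} {f : X → Y} {w : T.obj X} (hw : Holds T (fun x => P (f x)) w) :
    Holds T P (fmap T f w) := by
  obtain ⟨w', rfl⟩ := hw
  exact ⟨TVCat.fmap T (fun x => ⟨f x.1, x.2⟩) w', by simp only [fmap_comp]⟩

lemma Holds.of_fmap (hTBC : FunctorBC T) {P : Y → Prop} {f : X → Y} {w : T.obj X}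
    (hw : Holds T P (TVCat.fmap T f w)) : Holds T (fun x => P (f x)) w := by
  obtain ⟨w', h⟩ := hw
  obtain ⟨z, rfl, -⟩ := hTBC _ _ _ f (fun y : {y // P y} => y.1) w w' h.symm
  exact ⟨TVCat.fmap T (fun p => ⟨p.1.1, (congrArg P p.2).mpr p.1.2.2⟩) z, fmap_comp _ _ _⟩

lemma Holds.unit_iff (hT : Nontrivial T) (hT1 : Nonempty (T.obj PUnit.{u + 1} ≃ PUnit.{u + 1}))
    {P : X → Prop} {x : X} : Holds T P (unit T x) ↔ P x := by
  classical
  constructor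
  · rintro ⟨w, hw⟩
    by_contra hx
    -- Apply $T$ to the characteristic function of $P$: it is constantly true on the subset, so
    -- $T1=1$ yields $e(\mathrm{true})=e(\mathrm{false})$.
    have h := congrArg (TVCat.fmap T fun z => (ULift.up (decide (P z)) : ULift.{u} Bool)) hw
    rw [fmap_comp, fmap_unit] at h
    have hc : (fun z : {z // P z} => (ULift.up (decide (P z.1)) : ULift.{u} Bool))
        = fun _ => ULift.up true := by
      funext z
      simp [z.2]
    rw [hc, fmap_const hT1] at h
    have := unit_injective hT h
    simp [hx] at this
  · intro hx
    exact ⟨unit T ⟨x, hx⟩, fmap_unit _ _⟩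

end Holds

/-! ### The structure map `ξ` -/

section Xi

variable {T : Monad (Type u)} {V : Type u} [CompleteLattice V] {X Y : Type u}

lemma le_xi {v : V} {x : T.obj V} (h : Holds T (fun u => v ≤ u) x) : v ≤ xi T x :=
  le_sSup h

lemma xi_le_iff {b : V} {x : T.obj V} :
    xi T x ≤ b ↔ ∀ v : V, Holds T (fun u => v ≤ u) x → v ≤ b :=
  sSup_le_iff

lemma xi_unit (hT : Nontrivial T) (hT1 : Nonempty (T.obj PUnit.{u + 1} ≃ PUnit.{u + 1})) (v : V) :
    xi T (unit T v) = v :=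
  le_antisymm (xi_le_iff.2 fun _ h => (Holds.unit_iff hT hT1).1 h)
    (le_xi ((Holds.unit_iff hT hT1).2 le_rfl))

/-- The naturality square of $m$ at $\uparrow v\hookrightarrow V$ is a weak pullback, so $m(x)\in
T(\uparrow v)$ lifts $x$ to $TT(\uparrow v)$, and $\xi\ge v$ on $T(\uparrow v)$. -/
lemma xi_mult_le (hmBC : MultBC T) (x : T.obj (T.obj V)) :
    xi T (mult T x) ≤ xi T (fmap T (xi T) x) := by
  refine xi_le_iff.2 fun v ⟨w, hw⟩ => ?_
  obtain ⟨z, -, rfl⟩ := hmBC _ _ _ _ _ hw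
  refine le_xi (Holds.fmap (Holds.fmap (Holds.of_forall (fun s => ?_) z)))
  exact le_xi ⟨s, rfl⟩

lemma ext_le_iff {a : X → Y → V} {x : T.obj X} {y : T.obj Y} {b : V} :
    ext T a x y ≤ b ↔ ∀ (v : V) (w : T.obj {p : X × Y // v ≤ a p.1 p.2}),
      fmap T (fun p => p.1.1) w = x → fmap T (fun p => p.1.2) w = y → v ≤ b := by
  refine sSup_le_iff.trans ⟨fun h v w hx hy => h v ⟨w, hx, hy⟩, ?_⟩
  rintro h v ⟨w, hx, hy⟩
  exact h v w hx hy

lemma le_ext {a : X → Y → V} {v : V} (w : T.obj {p : X × Y // v ≤ a p.1 p.2}) :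
    v ≤ ext T a (fmap T (fun p => p.1.1) w) (fmap T (fun p => p.1.2) w) :=
  le_sSup ⟨w, rfl, rfl⟩

lemma xi_fmap_le_ext (hTBC : FunctorBC T) (a : X → Y → V) (w : T.obj (X × Y)) :
    xi T (fmap T (fun p => a p.1 p.2) w) ≤ ext T a (fmap T Prod.fst w) (fmap T Prod.snd w) := by
  refine xi_le_iff.2 fun v h => ?_
  obtain ⟨w', rfl⟩ := h.of_fmap hTBC
  simpa only [fmap_comp] using le_ext w'

lemma ext_comp_le {X' Y' : Type u} (a : X' → Y' → V) (f : X → X') (g : Y → Y') (x : T.obj X)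
    (y : T.obj Y) : ext T (fun x y => a (f x) (g y)) x y ≤ ext T a (fmap T f x) (fmap T g y) := by
  refine ext_le_iff.2 ?_
  rintro v w rfl rfl
  have h := le_ext (T := T) (a := a) (v := v)
    (fmap T (fun p : {p : X × Y // v ≤ a (f p.1) (g p.2)} => ⟨(f p.1.1, g p.1.2), p.2⟩) w)
  simpa only [fmap_comp] using h

variable [CommMonoid V]

lemma graph_self (f : X → Y) (x : X) : graph V f x (f x) = 1 := by
  simp [graph]

variable [IsQuantale V]

/-- By (BC), $T\alpha(w)\in T(\uparrow z)$ puts $w$ in $T\{\alpha\ge z\}$, hence in $T\{\beta\ge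
v\otimes z\}$. Residuation handles the join over $z$. -/
lemma mul_xi_fmap_le (hTBC : FunctorBC T) {v : V} {α β : X → V} (h : ∀ s, v * α s ≤ β s)
    (w : T.obj X) : v * xi T (fmap T α w) ≤ xi T (fmap T β w) := by
  rw [mul_comm, ← Quantale.leftMulResiduation_le_iff_mul_le]
  refine xi_le_iff.2 fun z hz => ?_
  rw [Quantale.leftMulResiduation_le_iff_mul_le, mul_comm]
  refine le_xi (Holds.fmap ((hz.of_fmap hTBC).mono fun s hs => ?_))
  exact (mul_le_mul_right hs v).trans (h s)

end Xi

/-! ### Function spaces -/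

section Structures

variable {T : Monad (Type u)} {V : Type u} [CompleteLattice V] [CommMonoid V] [IsQuantale V]
  {X Y : Type u}

lemma graph_mul_le_iff {f : X → Y} {x : X} {y : Y} {v b : V} :
    graph V f x y * v ≤ b ↔ (f x = y → v ≤ b) := by
  by_cases h : f x = y <;> simp [graph, h]

lemma le_homXi_iff {v b : V} {x : T.obj V} : v ≤ homXi T V x b ↔ v * xi T x ≤ b := by
  rw [homXi, Quantale.rightMulResiduation_le_iff_mul_le, mul_comm]

/-- A map `h : T X → V` belongs to `V ^ |X|` if and only if it satisfies `ξ · T h ≤ h · m_X`. -/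
lemma isFunctor_freeStr_iff (hT1 : Nonempty (T.obj PUnit.{u + 1} ≃ PUnit.{u + 1}))
    {h : T.obj X → V} :
    IsFunctor T (tensorStr (freeStr T V X) (pointStr T V)) (homXi T V)
        (fun p : T.obj X × PUnit.{u + 1} => h p.1) ↔
      ∀ x : T.obj (T.obj X), xi T (fmap T h x) ≤ h (mult T x) := by
  have hp : ∀ t s, pointStr T V t s = 1 := by
    intro t s
    have ht : t = unit T s := hT1.some.injective rfl
    rw [ht, pointStr, graph_self]
  simp only [IsFunctor, tensorStr, hp, freeStr, mul_one, graph_mul_le_iff, le_homXi_iff]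
  constructor
  · intro H x
    have := H (fmap T (fun z => (z, PUnit.unit)) x) (mult T x, PUnit.unit)
    simp only [fmap_comp, fmap_id] at this
    exact this trivial
  · rintro H w ⟨x, s⟩ rfl
    simpa only [fmap_comp] using H (fmap T Prod.fst w)

/-- The join defining the structure is attained, because $\otimes$ preserves joins. -/
lemma le_funStr_iff {r : T.obj (Presheaf T V X)} {h : Presheaf T V X} {v : V} :
    v ≤ funStr (freeStr T V X) (homXi T V) r h ↔
      ∀ q : T.obj (T.obj X × Presheaf T V X), fmap T Prod.snd q = r →
        v * xi T (fmap T (fun s => s.2.1 s.1) q) ≤ h.1 (mult T (fmap T Prod.fst q)) := by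
  constructor
  · intro hv q hq
    rw [← Quantale.leftMulResiduation_le_iff_mul_le]
    refine hv.trans (sSup_le fun z hz => ?_)
    rw [Quantale.leftMulResiduation_le_iff_mul_le]
    exact le_homXi_iff.1 (graph_mul_le_iff.1 (hz q _ hq) rfl)
  · intro H
    refine le_sSup fun q x hq => graph_mul_le_iff.2 ?_
    rintro rfl
    exact le_homXi_iff.2 (H q hq)

lemma IsCat.comap {b : T.obj Y → Y → V} (hb : IsCat T b) (f : X → Y) :
    IsCat T (fun x' x => b (fmap T f x') (f x)) where
  refl x := by
    rw [fmap_unit]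
    exact hb.refl _
  trans x'' x' x := by
    rw [fmap_mult]
    exact (mul_le_mul_left (ext_comp_le b (fmap T f) f x'' x') _).trans (hb.trans _ _ _)

/-- The function space `V ^ |X|` is a `(T, V)`-category. -/
lemma isCat_funStr (hTBC : FunctorBC T) (hmBC : MultBC T)
    (hT1 : Nonempty (T.obj PUnit.{u + 1} ≃ PUnit.{u + 1})) :
    IsCat T (funStr (freeStr T V X) (homXi T V)) where
  refl h := by
    refine le_funStr_iff.2 fun q hq => ?_
    -- As $e(h)$ is the image of $e_1(\star)$ under the constant map $h$, (BC) lifts $q$ to pairs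
    -- with second component $h$.
    obtain ⟨w, rfl, -⟩ := hTBC _ _ _ Prod.snd (fun _ : PUnit.{u + 1} => h) q (unit T PUnit.unit)
      (by rw [hq, fmap_unit])
    have H := (isFunctor_freeStr_iff hT1).1 h.2 (fmap T (fun p => p.1.1.1) w)
    have hev : (fun p : {p : (T.obj X × Presheaf T V X) × PUnit.{u + 1} // p.1.2 = h} =>
        p.1.1.2.1 p.1.1.1) = fun p => h.1 p.1.1.1 := by
      funext p
      rw [p.2]
    simp only [fmap_comp, one_mul, hev] at H ⊢
    exact H
  trans P p h := by
    rw [← Quantale.leftMulResiduation_le_iff_mul_le]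
    refine ext_le_iff.2 ?_
    rintro v W rfl rfl
    rw [Quantale.leftMulResiduation_le_iff_mul_le]
    refine le_funStr_iff.2 fun q hq => ?_
    -- (BC) for $m$ gives $q=m(Q)$. (BC) for $T$ then glues $Q$ and $W$ into $S$, whose points pair
    -- some $\mathfrak q'$ over $\mathfrak p'$ with an $h'$ such that $v$ lies below the structure
    -- at $(\mathfrak p',h')$.
    obtain ⟨Q, rfl, hQ⟩ := hmBC _ _ _ _ _ hq
    obtain ⟨S, rfl, rfl⟩ := hTBC _ _ _ _ _ _ _ hQ
    have hS := fun s : {s : T.obj (T.obj X × Presheaf T V X) × {p : T.obj (Presheaf T V X) ×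
        Presheaf T V X // v ≤ funStr (freeStr T V X) (homXi T V) p.1 p.2} //
        fmap T Prod.snd s.1 = s.2.1.1} => le_funStr_iff.1 s.1.2.2 s.1.1 s.2
    have h₁ := mul_xi_fmap_le hTBC hS S
    have h₂ := le_funStr_iff.1 (le_refl (funStr (freeStr T V X) (homXi T V)
      (fmap T (fun s => s.1.2.1.2) S) h))
      (fmap T (fun s => (mult T (fmap T Prod.fst s.1.1), s.1.2.1.2)) S) (fmap_comp _ _ _)
    have h₃ := xi_mult_le hmBC
      (fmap T (fmap T fun s : T.obj X × Presheaf T V X => s.2.1 s.1) (fmap T (fun s => s.1.1) S))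
    rw [← fmap_mult] at h₃
    have h₄ : mult T (fmap T (fun s => mult T (fmap T Prod.fst s.1.1)) S) =
        mult T (fmap T Prod.fst (mult T (fmap T (fun s => s.1.1) S))) := by
      rw [fmap_mult, ← mult_fmap_mult]
      simp only [fmap_comp]
    simp only [fmap_comp] at h₁ h₂ h₃ ⊢
    rw [h₄] at h₂
    calc _ = funStr (freeStr T V X) (homXi T V) (fmap T (fun s => s.1.2.1.2) S) h *
          (v * xi T (fmap T (fun s => s.2.1 s.1) (mult T (fmap T (fun s => s.1.1) S)))) := by
          ac_rfl
      _ ≤ _ := mul_le_mul_right ((mul_le_mul_right h₃ v).trans h₁) _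
      _ ≤ _ := h₂

/-! ### The Yoneda map -/

variable {a : T.obj X → X → V}

lemma IsCat.isFunctor_freeStr (ha : IsCat T a) (hTBC : FunctorBC T)
    (hT1 : Nonempty (T.obj PUnit.{u + 1} ≃ PUnit.{u + 1})) (x : X) :
    IsFunctor T (tensorStr (freeStr T V X) (pointStr T V)) (homXi T V)
      (fun p : T.obj X × PUnit.{u + 1} => a p.1 x) := by
  refine (isFunctor_freeStr_iff (h := fun x' => a x' x) hT1).2 fun x'' => ?_
  have h := xi_fmap_le_ext hTBC a (fmap T (fun x' => (x', x)) x'')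
  simp only [fmap_comp, fmap_id, fmap_const hT1] at h
  calc _ ≤ ext T a x'' (unit T x) := h
    _ = ext T a x'' (unit T x) * 1 := (mul_one _).symm
    _ ≤ ext T a x'' (unit T x) * a (unit T x) x := mul_le_mul_right (ha.refl x) _
    _ ≤ _ := ha.trans _ _ _

lemma IsCat.mStr_mul_le (ha : IsCat T a) (y x : T.obj X) (z : X) :
    mStr a y x * a x z ≤ a y z := by
  rw [← Quantale.leftMulResiduation_le_iff_mul_le]
  refine iSup₂_le ?_
  rintro w rfl
  rw [Quantale.leftMulResiduation_le_iff_mul_le]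
  exact ha.trans _ _ _

lemma IsCat.isFunctor_opStr (ha : IsCat T a) (hT : Nontrivial T) (hTBC : FunctorBC T)
    (hT1 : Nonempty (T.obj PUnit.{u + 1} ≃ PUnit.{u + 1})) (x : X) :
    IsFunctor T (opStr a) (homXi T V) (fun x' => a x' x) := by
  intro x'' x'
  refine (ext_le_iff (a := fun x y => mStr a y x)).2 ?_
  rintro v w rfl hw
  rw [le_homXi_iff, fmap_comp]
  refine (mul_xi_fmap_le hTBC (β := fun p => a p.1.2 x) (fun p => ?_) w).trans ?_
  · exact (mul_le_mul_left p.2 _).trans (ha.mStr_mul_le _ _ _)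
  -- The second projection of $w$ is $e(x')$, on which $\xi\cdot Ta(-,x)$ takes the value $a(x',x)$.
  · have h := congrArg (fmap T fun x' => a x' x) hw
    rw [fmap_comp, fmap_unit] at h
    rw [h, xi_unit hT hT1]

/-- The Yoneda map `x ↦ a (-, x)`. -/
def IsCat.yoneda (ha : IsCat T a) (hT : Nontrivial T) (hTBC : FunctorBC T)
    (hT1 : Nonempty (T.obj PUnit.{u + 1} ≃ PUnit.{u + 1})) (x : X) : Hat a :=
  ⟨⟨fun x' => a x' x, ha.isFunctor_freeStr hTBC hT1 x⟩, ha.isFunctor_opStr hT hTBC hT1 x⟩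

lemma IsCat.isFullyFaithful_yoneda (ha : IsCat T a) (hT : Nontrivial T) (hTBC : FunctorBC T)
    (hT1 : Nonempty (T.obj PUnit.{u + 1} ≃ PUnit.{u + 1})) :
    IsFullyFaithful T a (hatStr a) (ha.yoneda hT hTBC hT1) := by
  intro x' x
  rw [hatStr, fmap_comp]
  refine le_antisymm (le_funStr_iff.2 fun q hq => ?_) ?_
  · obtain ⟨w, rfl, rfl⟩ := hTBC _ _ _ _ _ _ _ hq
    have h := xi_fmap_le_ext hTBC a (fmap T (fun p => (p.1.1.1, p.1.2)) w)
    have hev : (fun p : {p : (T.obj X × Presheaf T V X) × X //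
        p.1.2 = (ha.yoneda hT hTBC hT1 p.2).1} => p.1.1.2.1 p.1.1.1) =
        fun p => a p.1.1.1 p.1.2 := by
      funext p
      rw [p.2]
      rfl
    simp only [fmap_comp, hev] at h ⊢
    rw [mul_comm]
    exact (mul_le_mul_left h _).trans (ha.trans _ _ _)
  -- Test on $T\langle e,y\rangle(x')$: evaluation gives $a(e(z),z)\ge k$.
  · have h := le_funStr_iff.1 (le_refl (funStr (freeStr T V X) (homXi T V)
      (fmap T (fun z => (ha.yoneda hT hTBC hT1 z).1) x') (ha.yoneda hT hTBC hT1 x).1))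
      (fmap T (fun z => (unit T z, (ha.yoneda hT hTBC hT1 z).1)) x') (fmap_comp _ _ _)
    simp only [fmap_comp, mult_fmap_unit] at h
    have h₁ : 1 ≤ xi T (fmap T (fun z => (ha.yoneda hT hTBC hT1 z).1.1 (unit T z)) x') :=
      le_xi (Holds.fmap (Holds.of_forall (fun z => ha.refl z) x'))
    calc _ = _ * 1 := (mul_one _).symm
      _ ≤ _ := mul_le_mul_right h₁ _
      _ ≤ _ := h

end Structures

end

end TVCat

theorem corollary4p2 (T : CategoryTheory.Monad (Type u))
    (V : Type u) [CompleteLattice V] [CommMonoid V] [IsQuantale V]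
    (hV : (1 : V) ≠ ⊥) (hccd : TVCat.IsCCD V)
    (hT : TVCat.Nontrivial T) (hTBC : TVCat.FunctorBC T) (hmBC : TVCat.MultBC T)
    (htensor : TVCat.TensorCompatible T V)
    (hT1 : Nonempty (T.obj PUnit.{u + 1} ≃ PUnit.{u + 1}))
    (X : Type u) (a : T.obj X → X → V) (ha : TVCat.IsCat T a) :
    TVCat.IsCat T (TVCat.hatStr a) ∧
    ∃ y : X → TVCat.Hat a,
      (∀ (x : X) (x' : T.obj X), (y x).1.1 x' = a x' x) ∧
      TVCat.IsFunctor T a (TVCat.hatStr a) y ∧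
      TVCat.IsFullyFaithful T a (TVCat.hatStr a) y := by
  have hff := ha.isFullyFaithful_yoneda hT hTBC hT1
  exact ⟨(TVCat.isCat_funStr hTBC hmBC hT1).comap _, ha.yoneda hT hTBC hT1, fun _ _ => rfl,
    fun x' x => (hff x' x).le, hff⟩
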